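/- Let $(\Omega,d)$ be a compact metric space, $h\ge 0$, and let $\alpha$ be a finite non-negative Borel measure on $\Omega$. For a finite non-negative Borel measure $\beta$ on $\Omega$ write $m_\beta=\beta(\Omega)$, let $\Gamma_0(\alpha,\beta)$ be the set of non-negative measures $\pi$ on $\Omega\times\Omega$ with $\pi(A\times\Omega)\le\alpha(A)$ and $\pi(\Omega\times A)\le\beta(A)$ for all measurable $A\subseteq\Omega$, put $m(\pi)=\pi(\Omega\times\Omega)$, and define $$\mathcal L_{D,h}(\alpha,\beta)=\inf_{\pi\in\Gamma_0(\alpha,\beta)}\int_{\Omega\times\Omega}d(x,y)\,d\pi(x,y)-h\,m(\pi).$$ (1) For every finite non-negative Borel measure $\beta$ on $\Omega$, $$\mathcal L_{D,h}(\alpha,\beta)=\sup_{f}\Big(\int_\Omega f\,d\alpha-\int_\Omega f\,d\beta-h\,m_\beta\Big),$$ where $f$ ranges over the 1-Lipschitz functions $f:\Omega\to\mathbb R$ with $-h\le f\le 0$, and the supremum is attained; a maximizer is called a potential of $(\alpha,\beta)$. (2) Let $\Omega'$ be a compact metric space (with metric also denoted $d$), $\beta$ a finite non-negative Borel measure on $\Omega'$,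 $p\in\mathbb N$, and let $T_\theta:\Omega'\to\Omega$ $(\theta\in\mathbb R^p)$ satisfy: every $\tilde\theta\in\mathbb R^p$ has a neighbourhood $U$ and a constant $\Delta$ with $d(T_\theta(y_1),T_{\theta'}(y_2))\le\Delta\,(\|\theta-\theta'\|+d(y_1,y_2))$ for all $\theta,\theta'\in U$ and $y_1,y_2\in\Omega'$. Let $\beta_\theta=(T_\theta)_\#\beta$ be the push-forward. Then $\theta\mapsto\mathcal L_{D,h}(\alpha,\beta_\theta)$ is locally Lipschitz, hence continuous, and differentiable at Lebesgue-almost every $\theta$. Moreover, let $\theta\in\mathbb R^p$ and let $f^*$ be any potential of $(\alpha,\beta_\theta)$. If $\theta'\mapsto\mathcal L_{D,h}(\alpha,\beta_{\theta'})$ is differentiable at $\theta$, and for $\beta$-almost every $y$ the function $\theta'\mapsto f^*(T_{\theta'}(y))$ (with $f^*$ fixed) is differentiable at $\theta$, then the gradients $\nabla_{\theta}(f^*\circ T_{\theta})(y)$ are $\beta$-integrable in $y$ and $$\nabla_\theta\mathcal L_{D,h}(\alpha,\beta_\theta)=-\int_{\Omega'}\nabla_\theta(f^*\circ T_\theta)(y)\,d\beta(y).$$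 -/

import Mathlib

open MeasureTheory Set Filter Topology
open scoped NNReal ENNReal

/-- `Γ₀(α, β)`: the sub-couplings of `α` and `β`, i.e. the non-negative measures `π` on `Ω × Ω` with
`π(A × Ω) ≤ α(A)` and `π(Ω × A) ≤ β(A)` for all measurable `A`. -/
def subCouplings {Ω : Type*} [MeasurableSpace Ω] (α β : Measure Ω) : Set (Measure (Ω × Ω)) :=
  {π | ∀ A : Set Ω, MeasurableSet A → π (A ×ˢ univ) ≤ α A ∧ π (univ ×ˢ A) ≤ β A}

/-- The primal cost `∫ d(x, y) dπ(x, y) - h m(π)` of a plan `π`. -/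
noncomputable def primalCost {Ω : Type*} [MetricSpace Ω] [MeasurableSpace Ω]
    (h : ℝ) (π : Measure (Ω × Ω)) : ℝ :=
  ∫ z, dist z.1 z.2 ∂π - h * π.real univ

/-- The bounded-distance Wasserstein-1 discrepancy `L_{D,h}(α, β)`: the infimum of the primal cost
over all sub-couplings. -/
noncomputable def boundedDistanceW1 {Ω : Type*} [MetricSpace Ω] [MeasurableSpace Ω]
    (h : ℝ) (α β : Measure Ω) : ℝ :=
  sInf (primalCost h '' subCouplings α β)

/-- The infimum defining `L_{D,h}` is over a nonempty set that is bounded below, so that it is a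
genuine infimum. -/
theorem isGLB_boundedDistanceW1 {Ω : Type*} [MetricSpace Ω] [MeasurableSpace Ω]
    {h : ℝ} (hh : 0 ≤ h) (α β : Measure Ω) [IsFiniteMeasure β] :
    IsGLB (primalCost h '' subCouplings α β) (boundedDistanceW1 h α β) := by
  refine isGLB_csInf ⟨_, mem_image_of_mem _ (show (0 : Measure (Ω × Ω)) ∈ _ from ?_)⟩
    ⟨-(h * β.real univ), ?_⟩
  · intro A _
    simp
  · rintro _ ⟨π, hπ, rfl⟩
    have h1 : π univ ≤ β univ := by
      have := (hπ univ MeasurableSet.univ).2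
      rwa [univ_prod_univ] at this
    have h2 : π.real univ ≤ β.real univ := ENNReal.toReal_mono (measure_ne_top β univ) h1
    have h3 : 0 ≤ ∫ z, dist z.1 z.2 ∂π := integral_nonneg fun _ => dist_nonneg
    have h4 := mul_le_mul_of_nonneg_left h2 hh
    unfold primalCost
    linarith

/-- The feasible functions of the Kantorovich-Rubinstein form: 1-Lipschitz with `-h ≤ f ≤ 0`. -/
def krFeasible (Ω : Type*) [MetricSpace Ω] (h : ℝ) : Set (Ω → ℝ) :=
  {f | LipschitzWith 1 f ∧ ∀ x, -h ≤ f x ∧ f x ≤ 0}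

/-- The Kantorovich-Rubinstein functional `∫ f dα - ∫ f dβ - h m_β`. -/
noncomputable def krFunctional {Ω : Type*} [MeasurableSpace Ω]
    (h : ℝ) (α β : Measure Ω) (f : Ω → ℝ) : ℝ :=
  ∫ x, f x ∂α - ∫ x, f x ∂β - h * β.real univ

/-- A potential: a maximizer of the Kantorovich-Rubinstein functional over the feasible functions. -/
def IsKRPotential {Ω : Type*} [MetricSpace Ω] [MeasurableSpace Ω]
    (h : ℝ) (α β : Measure Ω) (f : Ω → ℝ) : Prop :=
  f ∈ krFeasible Ω h ∧ ∀ g ∈ krFeasible Ω h, krFunctional h α β g ≤ krFunctional h α β f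

/-- Joint local Lipschitz condition on a parametrized transformation `T`: every parameter `θ₀` has a
neighbourhood `U` and a constant `Δ` with
`d(T_θ(y₁), T_θ'(y₂)) ≤ Δ (‖θ - θ'‖ + d(y₁, y₂))` for all `θ, θ' ∈ U` and all `y₁, y₂`. -/
def JointlyLocallyLipschitz {p : ℕ} {Ω' Ω : Type*} [MetricSpace Ω'] [MetricSpace Ω]
    (T : EuclideanSpace ℝ (Fin p) → Ω' → Ω) : Prop :=
  ∀ θ₀ : EuclideanSpace ℝ (Fin p), ∃ U ∈ 𝓝 θ₀, ∃ Δ : ℝ,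
    ∀ θ ∈ U, ∀ θ' ∈ U, ∀ y₁ y₂ : Ω',
      dist (T θ y₁) (T θ' y₂) ≤ Δ * (‖θ - θ'‖ + dist y₁ y₂)

/-!
The duality formula is linear programming duality. Weak duality, `krFunctional_le_primalCost`, is immediate.
For strong duality, the dual of maximizing `∫ (h - d) dπ` over sub-couplings `π` is to minimize
`∫ u dα + ∫ v dβ` over continuous `u, v ≥ 0` with `u(x) + v(y) ≥ h - d(x, y)`. The infimum is a
sublinear functional of the function to be dominated; a linear functional below it that touches it
at `h - d` (Hahn-Banach) is positive, hence a measure (Riesz-Markov-Kakutani), and this measure is a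
sub-coupling attaining the dual value: `exists_subCoupling_integral_eq_dominationPrice`.
Finally, every dual pair `(u, v)` can be replaced by `(-g, g + h)` with `g` feasible
(`exists_krFeasible_between`), which turns the dual into the Kantorovich-Rubinstein form; the
maximum there exists by Arzelà-Ascoli.

The dependence on `θ` is governed by an envelope theorem. By duality, `θ ↦ L(α, β_θ)` is a maximum of the functions
`θ ↦ ∫ f dα - ∫ f ∘ T_θ dβ - h m_β`, which are Lipschitz near each parameter with a constant that
does not depend on `f`. This gives the local Lipschitz property, and Rademacher's theorem the
differentiability almost everywhere. If `f` is a potential at `θ`, then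
`θ' ↦ L(α, β_θ') + ∫ f ∘ T_θ' dβ` has a minimum at `θ`, so its derivative there vanishes, and
the second term can be differentiated under the integral sign.
-/

open scoped CompactlySupported BoundedContinuousFunction

/-! ### Integration of continuous functions -/

theorem Continuous.integrable_of_compactSpace {X : Type*} [TopologicalSpace X] [CompactSpace X]
    [MeasurableSpace X] [OpensMeasurableSpace X] (μ : Measure X) [IsFiniteMeasure μ]
    {f : X → ℝ} (hf : Continuous f) : Integrable f μ :=
  hf.integrable_of_hasCompactSupport (HasCompactSupport.of_compactSpace f)

/-- Closed sets are handled by approximating their indicator from above by continuous functions,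
all measurable sets then by inner regularity. -/
theorem measure_le_of_forall_integral_le {X : Type*} [MetricSpace X]
    [MeasurableSpace X] [BorelSpace X] {μ ν : Measure X} [IsFiniteMeasure μ] [IsFiniteMeasure ν]
    (hle : ∀ f : C(X, ℝ), (∀ x, 0 ≤ f x) → ∫ x, f x ∂μ ≤ ∫ x, f x ∂ν) : μ ≤ ν := by
  have key : ∀ f : X →ᵇ ℝ≥0, ∫⁻ x, f x ∂μ ≤ ∫⁻ x, f x ∂ν := by
    intro f
    rw [← ENNReal.toReal_le_toReal (f.lintegral_lt_top_of_nnreal μ).ne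
      (f.lintegral_lt_top_of_nnreal ν).ne, f.toReal_lintegral_coe_eq_integral,
      f.toReal_lintegral_coe_eq_integral]
    exact hle ⟨fun x => (f x : ℝ), by fun_prop⟩ fun x => (f x).2
  have closed : ∀ F : Set X, IsClosed F → μ F ≤ ν F := fun F hF =>
    le_of_tendsto_of_tendsto' (HasOuterApproxClosed.tendsto_lintegral_apprSeq hF μ)
      (HasOuterApproxClosed.tendsto_lintegral_apprSeq hF ν) fun n => key _
  refine Measure.le_iff.2 fun A hA => ?_
  rw [hA.measure_eq_iSup_isClosed_of_ne_top (measure_ne_top μ A)]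
  exact iSup₂_le fun K hK => iSup_le fun hc => (closed K hc).trans (measure_mono hK)

/-! ### Weak duality and existence of potentials -/

section Potentials

variable {Ω : Type*} [MetricSpace Ω]

/-- The dual pairs `(u, v)`, with `u(x) + v(y) ≥ h - d(x, y)`, reduce to feasible functions:
such a pair can be improved to `(-g, g + h)`, where `g` is the `d`-transform
`x ↦ sup_y (-u(y) - d(x, y))` truncated below at `-h`. -/
theorem exists_krFeasible_between {h : ℝ} (hh : 0 ≤ h) {u v : Ω → ℝ} (hu : ∀ x, 0 ≤ u x)
    (hv : ∀ x, 0 ≤ v x) (huv : ∀ x y, h - dist x y ≤ u x + v y) :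
    ∃ g ∈ krFeasible Ω h, ∀ x, -u x ≤ g x ∧ g x ≤ v x - h := by
  have hbdd (x : Ω) : BddAbove (range fun y => -u y - dist x y) :=
    ⟨0, by rintro _ ⟨y, rfl⟩; linarith [hu y, dist_nonneg (x := x) (y := y)]⟩
  refine ⟨fun x => max (⨆ y, (-u y - dist x y)) (-h), ⟨?_, fun x => ⟨le_max_right _ _, ?_⟩⟩,
    fun x => ⟨?_, ?_⟩⟩
  · refine LipschitzWith.max_const (LipschitzWith.of_le_add fun x z => ?_) _
    have : Nonempty Ω := ⟨x⟩
    refine ciSup_le fun y => ?_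
    have := le_ciSup (hbdd z) y
    linarith [dist_triangle z x y, dist_comm z x]
  · have : Nonempty Ω := ⟨x⟩
    refine max_le (ciSup_le fun y => ?_) (neg_nonpos.2 hh)
    linarith [hu y, dist_nonneg (x := x) (y := y)]
  · refine le_max_of_le_left ?_
    have := le_ciSup (hbdd x) x
    simpa using this
  · have : Nonempty Ω := ⟨x⟩
    refine max_le (ciSup_le fun y => ?_) (by linarith [hv x])
    linarith [huv y x, dist_comm x y]

variable [CompactSpace Ω]

theorem isCompact_krFeasible (h : ℝ) :
    IsCompact {f : Ω →ᵇ ℝ | ⇑f ∈ krFeasible Ω h} := by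
  refine BoundedContinuousFunction.arzela_ascoli₂ (Icc (-h) 0) isCompact_Icc _ ?_
    (fun f x hf => hf.2 x) ?_
  · have : {f : Ω →ᵇ ℝ | ⇑f ∈ krFeasible Ω h} = ⋂ x, ⋂ y,
        ({f | dist (f x) (f y) ≤ dist x y} ∩ {f | -h ≤ f x} ∩ {f | f x ≤ 0}) := by
      ext f
      simp only [krFeasible, lipschitzWith_iff_dist_le_mul, NNReal.coe_one, one_mul, mem_ofPred_eq,
        mem_iInter, mem_inter_iff]
      exact ⟨fun hf x y => ⟨⟨hf.1 x y, (hf.2 x).1⟩, (hf.2 x).2⟩,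
        fun hf => ⟨fun x y => (hf x y).1.1, fun x => ⟨(hf x x).1.2, (hf x x).2⟩⟩⟩
    rw [this]
    refine isClosed_iInter fun x => isClosed_iInter fun y =>
      (IsClosed.inter (isClosed_le ?_ ?_) (isClosed_le ?_ ?_)).inter (isClosed_le ?_ ?_) <;>
    fun_prop
  · exact (LipschitzWith.uniformEquicontinuous _ 1 fun f => f.2.1).equicontinuous

variable [MeasurableSpace Ω] [BorelSpace Ω]

/-- Weak duality: `f(x) - f(y) ≤ d(x, y)` is integrated against `π`, whose marginals are at most `α`
and `β`, while `-f` and `f + h` are non-negative. -/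
theorem krFunctional_le_primalCost {h : ℝ} {α β : Measure Ω} [IsFiniteMeasure α]
    [IsFiniteMeasure β] {f : Ω → ℝ} (hf : f ∈ krFeasible Ω h) {π : Measure (Ω × Ω)}
    (hπ : π ∈ subCouplings α β) : krFunctional h α β f ≤ primalCost h π := by
  obtain ⟨hlip, hb⟩ := hf
  have hc := hlip.continuous
  have hfst : π.map Prod.fst ≤ α := Measure.le_iff.2 fun A hA => by
    rw [Measure.map_apply measurable_fst hA, ← prod_univ]
    exact (hπ A hA).1
  have hsnd : π.map Prod.snd ≤ β := Measure.le_iff.2 fun A hA => by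
    rw [Measure.map_apply measurable_snd hA, ← univ_prod]
    exact (hπ A hA).2
  have : IsFiniteMeasure π := ⟨by
    have := (hπ univ MeasurableSet.univ).2
    rw [univ_prod_univ] at this
    exact this.trans_lt (measure_lt_top β univ)⟩
  have h1 : ∫ z, -f z.1 ∂π ≤ ∫ x, -f x ∂α := by
    rw [← integral_map (f := fun x => -f x) measurable_fst.aemeasurable
      hc.neg.aestronglyMeasurable]
    exact integral_mono_measure hfst (Eventually.of_forall fun x => neg_nonneg.2 (hb x).2)
      (hc.neg.integrable_of_compactSpace α)
  have h2 : ∫ z, (f z.2 + h) ∂π ≤ ∫ x, (f x + h) ∂β := by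
    have hc' : Continuous fun x => f x + h := by fun_prop
    rw [← integral_map (f := fun x => f x + h) measurable_snd.aemeasurable
      hc'.aestronglyMeasurable]
    exact integral_mono_measure hsnd
      (Eventually.of_forall fun x => neg_le_iff_add_nonneg.1 (hb x).1)
      (hc'.integrable_of_compactSpace β)
  have h3 : ∫ z, (f z.1 - f z.2) ∂π ≤ ∫ z, dist z.1 z.2 ∂π :=
    integral_mono (Continuous.integrable_of_compactSpace π (by fun_prop))
      (Continuous.integrable_of_compactSpace π (by fun_prop)) fun z => by
        have := hlip.dist_le_mul z.1 z.2
        rw [NNReal.coe_one, one_mul, Real.dist_eq] at this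
        exact (le_abs_self _).trans this
  rw [integral_sub (Continuous.integrable_of_compactSpace π (by fun_prop))
    (Continuous.integrable_of_compactSpace π (by fun_prop))] at h3
  rw [integral_add (Continuous.integrable_of_compactSpace π (by fun_prop)) (integrable_const _),
    integral_add (hc.integrable_of_compactSpace β) (integrable_const _)] at h2
  simp only [integral_neg, integral_const, smul_eq_mul] at h1 h2
  unfold krFunctional primalCost
  linarith

/-- A potential exists, since the functional is continuous on a set compact by Arzelà-Ascoli. -/
theorem exists_isKRPotential {h : ℝ} (hh : 0 ≤ h) (α β : Measure Ω) [IsFiniteMeasure α]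
    [IsFiniteMeasure β] : ∃ f : Ω → ℝ, IsKRPotential h α β f := by
  have hcont : Continuous fun f : Ω →ᵇ ℝ => krFunctional h α β f := by
    have (μ : Measure Ω) [IsFiniteMeasure μ] : Continuous fun f : Ω →ᵇ ℝ => ∫ x, f x ∂μ :=
      (LipschitzWith.of_le_add_mul' (μ.real univ) fun f g => by
        have hle : ∫ x, f x ∂μ ≤ ∫ x, (g x + dist f g) ∂μ :=
          integral_mono (f.integrable μ) ((g.integrable μ).add (integrable_const _)) fun x => by
            have h1 := le_abs_self (f x - g x)
            have h2 : |f x - g x| ≤ dist f g :=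
              (Real.dist_eq _ _).ge.trans (BoundedContinuousFunction.dist_coe_le_dist x)
            linarith
        rw [integral_add (g.integrable μ) (integrable_const _), integral_const,
          smul_eq_mul] at hle
        exact hle).continuous
    exact ((this α).sub (this β)).sub continuous_const
  obtain ⟨f, hf, hmax⟩ := (isCompact_krFeasible (Ω := Ω) h).exists_isMaxOn
    ⟨0, (LipschitzWith.const (0 : ℝ)).weaken zero_le_one, fun x => ⟨neg_nonpos.2 hh, le_rfl⟩⟩
    hcont.continuousOn
  exact ⟨f, hf, fun g hg => hmax (a := BoundedContinuousFunction.mkOfCompact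
    ⟨g, hg.1.continuous⟩) hg⟩

end Potentials

/-! ### The dual linear program -/

section Domination

variable {Ω : Type*} [MetricSpace Ω] [MeasurableSpace Ω]

/-- The values `∫ u dα + ∫ v dβ` of the pairs of continuous functions `u, v ≥ 0` whose sum
`u(x) + v(y)` dominates `φ(x, y)`. Their infimum is the linear programming dual of maximizing
`∫ φ dπ` over the sub-couplings `π` of `α` and `β`. -/
def dominatingCosts (α β : Measure Ω) (φ : Ω × Ω → ℝ) : Set ℝ :=
  {r | ∃ u v : C(Ω, ℝ), (∀ x, 0 ≤ u x) ∧ (∀ y, 0 ≤ v y) ∧ (∀ z, φ z ≤ u z.1 + v z.2) ∧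
    r = ∫ x, u x ∂α + ∫ y, v y ∂β}

theorem dominatingCosts_bddBelow (α β : Measure Ω) (φ : Ω × Ω → ℝ) :
    BddBelow (dominatingCosts α β φ) := by
  refine ⟨0, ?_⟩
  rintro _ ⟨u, v, hu, hv, -, rfl⟩
  exact add_nonneg (integral_nonneg hu) (integral_nonneg hv)

theorem dominatingCosts_smul {α β : Measure Ω} {φ : Ω × Ω → ℝ} {r c : ℝ} (hc : 0 ≤ c)
    (hr : r ∈ dominatingCosts α β φ) : c * r ∈ dominatingCosts α β (c • φ) := by
  obtain ⟨u, v, hu, hv, huv, rfl⟩ := hr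
  refine ⟨c • u, c • v, fun x => mul_nonneg hc (hu x), fun x => mul_nonneg hc (hv x),
    fun z => ?_, ?_⟩
  · simpa [mul_add] using mul_le_mul_of_nonneg_left (huv z) hc
  · simp [integral_const_mul, mul_add]

/-- The infimum of the values `∫ u dα + ∫ v dβ` over pairs of continuous functions `u, v ≥ 0` whose
sum dominates `φ`; a sublinear functional of the continuous function `φ`. -/
noncomputable def dominationPrice (α β : Measure Ω) (φ : Ω × Ω → ℝ) : ℝ :=
  sInf (dominatingCosts α β φ)

theorem dominationPrice_le {α β : Measure Ω} {φ : Ω × Ω → ℝ} {r : ℝ}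
    (hr : r ∈ dominatingCosts α β φ) : dominationPrice α β φ ≤ r :=
  csInf_le (dominatingCosts_bddBelow α β φ) hr

theorem dominationPrice_nonneg (α β : Measure Ω) (φ : Ω × Ω → ℝ) : 0 ≤ dominationPrice α β φ := by
  refine Real.sInf_nonneg ?_
  rintro _ ⟨u, v, hu, hv, -, rfl⟩
  exact add_nonneg (integral_nonneg hu) (integral_nonneg hv)

theorem dominationPrice_of_nonpos (α β : Measure Ω) {φ : Ω × Ω → ℝ} (hφ : ∀ z, φ z ≤ 0) :
    dominationPrice α β φ = 0 :=
  le_antisymm (dominationPrice_le ⟨0, 0, fun _ => le_rfl, fun _ => le_rfl,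
    fun z => by simpa using hφ z, by simp⟩) (dominationPrice_nonneg α β φ)

variable [CompactSpace Ω]

theorem dominatingCosts_nonempty (α β : Measure Ω) {φ : Ω × Ω → ℝ} (hφ : Continuous φ) :
    (dominatingCosts α β φ).Nonempty := by
  obtain ⟨C, hC⟩ := (isCompact_range hφ).bddAbove
  exact ⟨_, ContinuousMap.const Ω (max C 0), 0, fun x => le_max_right _ _, fun y => le_rfl,
    fun z => by simpa using Or.inl (hC (mem_range_self z)), rfl⟩

theorem dominationPrice_smul (α β : Measure Ω) {φ : Ω × Ω → ℝ} (hφ : Continuous φ) {c : ℝ}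
    (hc : 0 < c) : dominationPrice α β (c • φ) = c * dominationPrice α β φ := by
  have le : ∀ {c : ℝ}, 0 < c → ∀ {φ : Ω × Ω → ℝ}, Continuous φ →
      dominationPrice α β (c • φ) ≤ c * dominationPrice α β φ := by
    intro c hc φ hφ
    rw [← div_le_iff₀' hc]
    refine le_csInf (dominatingCosts_nonempty α β hφ) fun r hr => ?_
    rw [div_le_iff₀' hc]
    exact dominationPrice_le (dominatingCosts_smul hc.le hr)
  refine le_antisymm (le hc hφ) ?_
  have := le (inv_pos.2 hc) (hφ.const_smul c)
  rwa [smul_smul, inv_mul_cancel₀ hc.ne', one_smul, ← div_eq_inv_mul, le_div_iff₀' hc] at this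

variable [BorelSpace Ω]

theorem dominatingCosts_add {α β : Measure Ω} [IsFiniteMeasure α] [IsFiniteMeasure β]
    {φ ψ : Ω × Ω → ℝ} {r s : ℝ} (hr : r ∈ dominatingCosts α β φ)
    (hs : s ∈ dominatingCosts α β ψ) : r + s ∈ dominatingCosts α β (φ + ψ) := by
  obtain ⟨u, v, hu, hv, huv, rfl⟩ := hr
  obtain ⟨u', v', hu', hv', huv', rfl⟩ := hs
  refine ⟨u + u', v + v', fun x => add_nonneg (hu x) (hu' x),
    fun x => add_nonneg (hv x) (hv' x), fun z => ?_, ?_⟩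
  · have h1 := huv z
    have h2 := huv' z
    simp only [Pi.add_apply, ContinuousMap.add_apply]
    linarith
  · simp only [ContinuousMap.add_apply]
    rw [integral_add (u.continuous.integrable_of_compactSpace α)
      (u'.continuous.integrable_of_compactSpace α),
      integral_add (v.continuous.integrable_of_compactSpace β)
      (v'.continuous.integrable_of_compactSpace β)]
    ring

theorem dominationPrice_add_le (α β : Measure Ω) [IsFiniteMeasure α] [IsFiniteMeasure β]
    {φ ψ : Ω × Ω → ℝ} (hφ : Continuous φ) (hψ : Continuous ψ) :
    dominationPrice α β (φ + ψ) ≤ dominationPrice α β φ + dominationPrice α β ψ := by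
  rw [← sub_le_iff_le_add]
  refine le_csInf (dominatingCosts_nonempty α β hφ) fun r hr => ?_
  rw [sub_le_iff_le_add, ← sub_le_iff_le_add']
  refine le_csInf (dominatingCosts_nonempty α β hψ) fun s hs => ?_
  rw [sub_le_iff_le_add']
  exact dominationPrice_le (dominatingCosts_add hr hs)

/-- The dual value is attained by a sub-coupling. Hahn-Banach gives a linear functional dominated by
`dominationPrice α β` that agrees with it at `c`. Domination makes the functional positive, so that
it is integration against a measure `π`, and then, tested on functions of one variable, bounds the
marginals of `π` by `α` and `β`. -/
theorem exists_subCoupling_integral_eq_dominationPrice (α β : Measure Ω) [IsFiniteMeasure α]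
    [IsFiniteMeasure β] {c : Ω × Ω → ℝ} (hc : Continuous c) :
    ∃ π ∈ subCouplings α β, IsFiniteMeasure π ∧ ∫ z, c z ∂π = dominationPrice α β c := by
  let ofCont (φ : Ω × Ω → ℝ) (hφ : Continuous φ) : C_c(Ω × Ω, ℝ) :=
    ⟨⟨φ, hφ⟩, HasCompactSupport.of_compactSpace _⟩
  have price_zero : dominationPrice α β (0 : Ω × Ω → ℝ) = 0 :=
    dominationPrice_of_nonpos α β fun _ => le_rfl
  -- The functional on the line through `c`; it is well defined also when `c = 0`.
  let ℓ : C_c(Ω × Ω, ℝ) →ₗ.[ℝ] ℝ :=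
    LinearPMap.mkSpanSingleton' (σ := RingHom.id ℝ) (ofCont c hc) (dominationPrice α β c) <| by
      intro t ht
      rcases eq_or_ne t 0 with rfl | ht0
      · simp
      · have : c = 0 := funext fun z => by
          have := DFunLike.congr_fun ((smul_eq_zero.1 ht).resolve_left ht0) z
          exact this
        simp [this, price_zero]
  obtain ⟨g, hgℓ, hgN⟩ := exists_extension_of_le_sublinear ℓ (fun φ => dominationPrice α β φ)
    (fun t ht φ => dominationPrice_smul α β φ.continuous ht)
    (fun φ ψ => dominationPrice_add_le α β φ.continuous ψ.continuous) <| by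
      rintro ⟨φ, hφ⟩
      obtain ⟨t, rfl⟩ := Submodule.mem_span_singleton.1 hφ
      rw [LinearPMap.mkSpanSingleton'_apply]
      change t * dominationPrice α β c ≤ dominationPrice α β (t • c)
      rcases lt_trichotomy t 0 with ht | rfl | ht
      · exact (mul_nonpos_of_nonpos_of_nonneg ht.le (dominationPrice_nonneg α β c)).trans
          (dominationPrice_nonneg α β _)
      · simp [price_zero]
      · exact (dominationPrice_smul α β hc ht).ge
  -- Positivity: `g (-φ) ≤ dominationPrice α β (-φ) = 0` for `φ ≥ 0`.
  let Λ : C_c(Ω × Ω, ℝ) →ₚ[ℝ] ℝ := PositiveLinearMap.mk₀ g fun φ hφ => by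
    have := hgN (-φ)
    rw [map_neg] at this
    have h0 : dominationPrice α β (-φ : C_c(Ω × Ω, ℝ)) = 0 :=
      dominationPrice_of_nonpos α β fun z => neg_nonpos.2 (hφ z)
    linarith
  have hΛ (φ : Ω × Ω → ℝ) (hφ : Continuous φ) :
      ∫ z, φ z ∂(RealRMK.rieszMeasure Λ) = g (ofCont φ hφ) :=
    RealRMK.integral_rieszMeasure Λ (ofCont φ hφ)
  refine ⟨RealRMK.rieszMeasure Λ, ?_, inferInstance, ?_⟩
  · have hfst : (RealRMK.rieszMeasure Λ).map Prod.fst ≤ α := by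
      refine measure_le_of_forall_integral_le fun u hu => ?_
      rw [integral_map measurable_fst.aemeasurable u.continuous.aestronglyMeasurable,
        hΛ _ (by fun_prop)]
      exact (hgN _).trans (dominationPrice_le ⟨u, 0, hu, fun _ => le_rfl,
        fun z => (add_zero _).ge, by simp⟩)
    have hsnd : (RealRMK.rieszMeasure Λ).map Prod.snd ≤ β := by
      refine measure_le_of_forall_integral_le fun v hv => ?_
      rw [integral_map measurable_snd.aemeasurable v.continuous.aestronglyMeasurable,
        hΛ _ (by fun_prop)]
      exact (hgN _).trans (dominationPrice_le ⟨0, v, fun _ => le_rfl, hv,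
        fun z => (zero_add _).ge, by simp⟩)
    intro A hA
    rw [prod_univ, univ_prod, ← Measure.map_apply measurable_fst hA,
      ← Measure.map_apply measurable_snd hA]
    exact ⟨hfst A, hsnd A⟩
  · rw [hΛ c hc, hgℓ ⟨ofCont c hc, Submodule.mem_span_singleton_self _⟩]
    exact LinearPMap.mkSpanSingleton'_apply_self _ _ _ _

end Domination

/-! ### Strong duality -/

section StrongDuality

variable {Ω : Type*} [MetricSpace Ω] [CompactSpace Ω] [MeasurableSpace Ω] [BorelSpace Ω]

/-- Strong duality: the maximum of the Kantorovich-Rubinstein functional is the infimum of the primal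
cost, which some sub-coupling attains. -/
theorem IsKRPotential.krFunctional_eq {h : ℝ} (hh : 0 ≤ h) {α β : Measure Ω} [IsFiniteMeasure α]
    [IsFiniteMeasure β] {f : Ω → ℝ} (hf : IsKRPotential h α β f) :
    krFunctional h α β f = boundedDistanceW1 h α β := by
  refine le_antisymm ((isGLB_boundedDistanceW1 hh α β).2 ?_) ?_
  · rintro _ ⟨π, hπ, rfl⟩
    exact krFunctional_le_primalCost hf.1 hπ
  have hcont : Continuous fun z : Ω × Ω => h - dist z.1 z.2 := by fun_prop
  obtain ⟨π, hπ, hfin, hint⟩ := exists_subCoupling_integral_eq_dominationPrice α β hcont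
  refine ((isGLB_boundedDistanceW1 hh α β).1 (mem_image_of_mem _ hπ)).trans ?_
  have hcost : primalCost h π = -dominationPrice α β fun z : Ω × Ω => h - dist z.1 z.2 := by
    rw [← hint, integral_sub (integrable_const _)
      (Continuous.integrable_of_compactSpace π (by fun_prop))]
    simp only [integral_const, smul_eq_mul, primalCost]
    ring
  rw [hcost, neg_le]
  refine le_csInf (dominatingCosts_nonempty α β hcont) ?_
  rintro _ ⟨u, v, hu, hv, huv, rfl⟩
  obtain ⟨g, hg, hgb⟩ := exists_krFeasible_between hh hu hv fun x y => huv (x, y)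
  have hgc := hg.1.continuous
  have h1 : ∫ x, -u x ∂α ≤ ∫ x, g x ∂α :=
    integral_mono (u.continuous.neg.integrable_of_compactSpace α)
      (hgc.integrable_of_compactSpace α) fun x => (hgb x).1
  have h2 : ∫ x, g x ∂β ≤ ∫ x, (v x - h) ∂β :=
    integral_mono (hgc.integrable_of_compactSpace β)
      (Continuous.integrable_of_compactSpace β (by fun_prop)) fun x => (hgb x).2
  rw [integral_sub (v.continuous.integrable_of_compactSpace β) (integrable_const _)] at h2
  simp only [integral_neg, integral_const, smul_eq_mul] at h1 h2
  have h3 := hf.2 g hg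
  unfold krFunctional at h3 ⊢
  linarith

theorem krFunctional_le_boundedDistanceW1 {h : ℝ} (hh : 0 ≤ h) (α β : Measure Ω)
    [IsFiniteMeasure α] [IsFiniteMeasure β] {f : Ω → ℝ} (hf : f ∈ krFeasible Ω h) :
    krFunctional h α β f ≤ boundedDistanceW1 h α β := by
  obtain ⟨g, hg⟩ := exists_isKRPotential hh α β
  exact (hg.2 f hf).trans (hg.krFunctional_eq hh).le

end StrongDuality

/-! ### Differentiability and gradients -/

/-- Rademacher's theorem for locally Lipschitz functions. -/
theorem LocallyLipschitz.ae_differentiableAt {E F : Type*} [NormedAddCommGroup E]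
    [NormedSpace ℝ E] [FiniteDimensional ℝ E] [MeasurableSpace E] [BorelSpace E]
    [NormedAddCommGroup F] [NormedSpace ℝ F] [FiniteDimensional ℝ F] {f : E → F}
    (hf : LocallyLipschitz f) (μ : Measure E) [μ.IsAddHaarMeasure] :
    ∀ᵐ x ∂μ, DifferentiableAt ℝ f x := by
  have := FiniteDimensional.proper ℝ E
  refine measure_null_of_locally_null _ fun x _ => ?_
  obtain ⟨K, t, ht, hK⟩ := hf x
  refine ⟨{x | ¬DifferentiableAt ℝ f x} ∩ interior t,
    inter_mem self_mem_nhdsWithin (mem_nhdsWithin_of_mem_nhds (interior_mem_nhds.2 ht)), ?_⟩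
  refine measure_mono_null ?_ (hK.ae_differentiableWithinAt_of_mem (μ := μ))
  rintro y ⟨hy, hyt⟩ h
  exact hy ((h (interior_subset hyt)).differentiableAt (mem_interior_iff_mem_nhds.1 hyt))

theorem integrable_gradient_and_integral_eq {X E : Type*} [MeasurableSpace X]
    [NormedAddCommGroup E] [InnerProductSpace ℝ E] [CompleteSpace E] {μ : Measure X}
    {F : X → E → ℝ} {x : E} (hF : Integrable (fun a => fderiv ℝ (F a) x) μ) :
    Integrable (fun a => gradient (F a) x) μ ∧
      ∫ a, gradient (F a) x ∂μ = (InnerProductSpace.toDual ℝ E).symm (∫ a, fderiv ℝ (F a) x ∂μ) := by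
  have hint : Integrable (fun a => gradient (F a) x) μ :=
    hF.norm.mono' ((InnerProductSpace.toDual ℝ E).symm.continuous.comp_aestronglyMeasurable hF.1)
      (Eventually.of_forall fun a => by simp [gradient])
  refine ⟨hint, ext_inner_left ℝ fun v => ?_⟩
  rw [← integral_inner hint, real_inner_comm, InnerProductSpace.toDual_symm_apply,
    ContinuousLinearMap.integral_apply hF]
  exact integral_congr_ae (Eventually.of_forall fun a => by
    simp only [gradient]
    rw [real_inner_comm, InnerProductSpace.toDual_symm_apply])

/-! ### Jointly locally Lipschitz transformations -/

namespace JointlyLocallyLipschitz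

variable {p : ℕ} {Ω' Ω : Type*} [MetricSpace Ω'] [MetricSpace Ω]
  {T : EuclideanSpace ℝ (Fin p) → Ω' → Ω}

theorem exists_nonneg (hT : JointlyLocallyLipschitz T) (θ₀ : EuclideanSpace ℝ (Fin p)) :
    ∃ U ∈ 𝓝 θ₀, ∃ Δ : ℝ, 0 ≤ Δ ∧ ∀ θ ∈ U, ∀ θ' ∈ U, ∀ y₁ y₂ : Ω',
      dist (T θ y₁) (T θ' y₂) ≤ Δ * (‖θ - θ'‖ + dist y₁ y₂) := by
  obtain ⟨U, hU, Δ, h⟩ := hT θ₀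
  exact ⟨U, hU, max Δ 0, le_max_right _ _, fun θ hθ θ' hθ' y₁ y₂ => (h θ hθ θ' hθ' y₁ y₂).trans
    (mul_le_mul_of_nonneg_right (le_max_left _ _) (by positivity))⟩

theorem continuous_uncurry (hT : JointlyLocallyLipschitz T) :
    Continuous fun q : EuclideanSpace ℝ (Fin p) × Ω' => T q.1 q.2 := by
  refine continuous_iff_continuousAt.2 fun ⟨θ₀, y₀⟩ => ?_
  obtain ⟨U, hU, Δ, h⟩ := hT θ₀
  refine tendsto_iff_dist_tendsto_zero.2 (squeeze_zero' (Eventually.of_forall fun _ => dist_nonneg)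
    (g := fun q : EuclideanSpace ℝ (Fin p) × Ω' => Δ * (‖q.1 - θ₀‖ + dist q.2 y₀)) ?_ ?_)
  · filter_upwards [continuous_fst.continuousAt.preimage_mem_nhds hU] with q hq
    exact h _ hq _ (mem_of_mem_nhds hU) _ _
  · have : Continuous fun q : EuclideanSpace ℝ (Fin p) × Ω' =>
        Δ * (‖q.1 - θ₀‖ + dist q.2 y₀) := by fun_prop
    simpa using this.tendsto (θ₀, y₀)

theorem continuous_apply (hT : JointlyLocallyLipschitz T) (θ : EuclideanSpace ℝ (Fin p)) :
    Continuous (T θ) :=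
  hT.continuous_uncurry.comp (Continuous.prodMk_right θ)

end JointlyLocallyLipschitz

/-! ### The discrepancy as a function of the parameter -/

section Parameter

variable {Ω Ω' : Type*} [MetricSpace Ω] [MetricSpace Ω'] [MeasurableSpace Ω'] [BorelSpace Ω']

theorem krFunctional_map [MeasurableSpace Ω] [BorelSpace Ω] (h : ℝ) (α : Measure Ω)
    (β : Measure Ω') {S : Ω' → Ω} (hS : Continuous S) {f : Ω → ℝ} (hf : Continuous f) :
    krFunctional h α (β.map S) f = ∫ x, f x ∂α - ∫ y, f (S y) ∂β - h * β.real univ := by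
  rw [krFunctional, integral_map hS.measurable.aemeasurable hf.aestronglyMeasurable,
    map_measureReal_apply hS.measurable MeasurableSet.univ, preimage_univ]

variable [CompactSpace Ω']

/-- Differentiation under the integral sign, dominated by the Lipschitz constant of `T`. -/
theorem hasFDerivAt_integral_comp {p : ℕ} {T : EuclideanSpace ℝ (Fin p) → Ω' → Ω}
    (hT : JointlyLocallyLipschitz T) (β : Measure Ω') [IsFiniteMeasure β] {f : Ω → ℝ}
    (hf : LipschitzWith 1 f) {θ : EuclideanSpace ℝ (Fin p)}
    (hd : ∀ᵐ y ∂β, DifferentiableAt ℝ (fun θ' => f (T θ' y)) θ) :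
    Integrable (fun y => fderiv ℝ (fun θ' => f (T θ' y)) θ) β ∧
      HasFDerivAt (fun θ' => ∫ y, f (T θ' y) ∂β)
        (∫ y, fderiv ℝ (fun θ' => f (T θ' y)) θ ∂β) θ := by
  obtain ⟨U, hU, Δ, hΔ, h⟩ := hT.exists_nonneg θ
  have hcont (θ' : EuclideanSpace ℝ (Fin p)) : Continuous fun y => f (T θ' y) :=
    hf.continuous.comp (hT.continuous_apply θ')
  have hjoint : Continuous (Function.uncurry fun (y : Ω') (θ' : EuclideanSpace ℝ (Fin p)) =>
      f (T θ' y)) :=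
    hf.continuous.comp (hT.continuous_uncurry.comp continuous_swap)
  refine hasFDerivAt_integral_of_dominated_loc_of_lip' (bound := fun _ => Δ) hU
    (fun θ' _ => (hcont θ').aestronglyMeasurable) ((hcont θ).integrable_of_compactSpace β)
    ((measurable_fderiv_with_param ℝ hjoint).comp measurable_prodMk_right).aestronglyMeasurable
    (Eventually.of_forall fun y θ' hθ' => ?_) (integrable_const _)
    (hd.mono fun y hy => hy.hasFDerivAt)
  have h1 := hf.dist_le_mul (T θ' y) (T θ y)
  rw [NNReal.coe_one, one_mul, dist_eq_norm] at h1
  have h2 := h θ' hθ' θ (mem_of_mem_nhds hU) y y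
  rw [dist_self, add_zero] at h2
  exact h1.trans h2

variable [CompactSpace Ω] [MeasurableSpace Ω] [BorelSpace Ω]

/-- A potential at `θ` is a competitor at `θ'`, so that the values at `θ` and `θ'` differ by at most
the change of `∫ f ∘ T_θ dβ`. -/
theorem locallyLipschitz_boundedDistanceW1_map {h : ℝ} (hh : 0 ≤ h) (α : Measure Ω)
    [IsFiniteMeasure α] (β : Measure Ω') [IsFiniteMeasure β] {p : ℕ}
    {T : EuclideanSpace ℝ (Fin p) → Ω' → Ω} (hT : JointlyLocallyLipschitz T) :
    LocallyLipschitz fun θ => boundedDistanceW1 h α (β.map (T θ)) := by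
  intro θ₀
  obtain ⟨U, hU, Δ, hΔ, h⟩ := hT.exists_nonneg θ₀
  refine ⟨_, U, hU, LipschitzOnWith.of_le_add_mul' (Δ * β.real univ) fun θ hθ θ' hθ' => ?_⟩
  obtain ⟨f, hf⟩ := exists_isKRPotential hh α (β.map (T θ))
  have hfc := hf.1.1.continuous
  have hθc := hT.continuous_apply θ
  have hθc' := hT.continuous_apply θ'
  have h1 := krFunctional_le_boundedDistanceW1 hh α (β.map (T θ')) hf.1
  rw [← hf.krFunctional_eq hh, krFunctional_map _ _ _ hθc hfc]
  rw [krFunctional_map _ _ _ hθc' hfc] at h1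
  have h2 : ∫ y, f (T θ' y) ∂β ≤ ∫ y, (f (T θ y) + Δ * dist θ θ') ∂β :=
    integral_mono (Continuous.integrable_of_compactSpace β (by fun_prop))
      (Continuous.integrable_of_compactSpace β (by fun_prop)) fun y => by
        have h3 := hf.1.1.dist_le_mul (T θ' y) (T θ y)
        rw [NNReal.coe_one, one_mul, Real.dist_eq] at h3
        have h4 := h θ hθ θ' hθ' y y
        rw [dist_self, add_zero, dist_comm, ← dist_eq_norm] at h4
        have := le_abs_self (f (T θ' y) - f (T θ y))
        simp only
        linarith
  rw [integral_add (Continuous.integrable_of_compactSpace β (by fun_prop)) (integrable_const _),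
    integral_const, smul_eq_mul] at h2
  linarith

/-- Envelope theorem: `L(α, β_θ') + ∫ f ∘ T_θ' dβ` is minimal at `θ' = θ`, since `f` is feasible for
every `θ'` and optimal at `θ`. -/
theorem fderiv_boundedDistanceW1_map {h : ℝ} (hh : 0 ≤ h) {α : Measure Ω}
    [IsFiniteMeasure α] {β : Measure Ω'} [IsFiniteMeasure β] {p : ℕ}
    {T : EuclideanSpace ℝ (Fin p) → Ω' → Ω} (hT : JointlyLocallyLipschitz T)
    {θ : EuclideanSpace ℝ (Fin p)} {f : Ω → ℝ} (hf : IsKRPotential h α (β.map (T θ)) f)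
    (hL : DifferentiableAt ℝ (fun θ' => boundedDistanceW1 h α (β.map (T θ'))) θ)
    (hd : ∀ᵐ y ∂β, DifferentiableAt ℝ (fun θ' => f (T θ' y)) θ) :
    fderiv ℝ (fun θ' => boundedDistanceW1 h α (β.map (T θ'))) θ =
      -∫ y, fderiv ℝ (fun θ' => f (T θ' y)) θ ∂β := by
  have hfc := hf.1.1.continuous
  have hval (θ') := krFunctional_map h α β (hT.continuous_apply θ') hfc
  have hmin : IsLocalMin (fun θ' => boundedDistanceW1 h α (β.map (T θ')) +
      ∫ y, f (T θ' y) ∂β) θ := by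
    refine Eventually.of_forall fun θ' => ?_
    have h1 := krFunctional_le_boundedDistanceW1 hh α (β.map (T θ')) hf.1
    have h2 := hf.krFunctional_eq hh
    rw [hval] at h1 h2
    linarith
  have := hmin.hasFDerivAt_eq_zero
    (hL.hasFDerivAt.add (hasFDerivAt_integral_comp hT β hf.1.1 hd).2)
  exact eq_neg_of_add_eq_zero_left this

end Parameter

theorem theorem1 {Ω : Type*} [MetricSpace Ω] [CompactSpace Ω] [MeasurableSpace Ω] [BorelSpace Ω]
    (h : ℝ) (hh : 0 ≤ h) (α : Measure Ω) [IsFiniteMeasure α] :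
    (∀ (β : Measure Ω) [IsFiniteMeasure β],
      IsLUB (krFunctional h α β '' krFeasible Ω h) (boundedDistanceW1 h α β) ∧
      ∃ f : Ω → ℝ, IsKRPotential h α β f) ∧
    (∀ {Ω' : Type*} [MetricSpace Ω'] [CompactSpace Ω'] [MeasurableSpace Ω'] [BorelSpace Ω']
      (β : Measure Ω') [IsFiniteMeasure β] (p : ℕ) (T : EuclideanSpace ℝ (Fin p) → Ω' → Ω),
      JointlyLocallyLipschitz T →
      LocallyLipschitz (fun θ => boundedDistanceW1 h α (β.map (T θ))) ∧
      Continuous (fun θ => boundedDistanceW1 h α (β.map (T θ))) ∧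
      (∀ᵐ θ, DifferentiableAt ℝ (fun θ => boundedDistanceW1 h α (β.map (T θ))) θ) ∧
      (∀ (θ : EuclideanSpace ℝ (Fin p)) (f : Ω → ℝ),
        IsKRPotential h α (β.map (T θ)) f →
        DifferentiableAt ℝ (fun θ' => boundedDistanceW1 h α (β.map (T θ'))) θ →
        (∀ᵐ y ∂β, DifferentiableAt ℝ (fun θ' => f (T θ' y)) θ) →
        Integrable (fun y => gradient (fun θ' => f (T θ' y)) θ) β ∧
        gradient (fun θ' => boundedDistanceW1 h α (β.map (T θ'))) θ =
          -∫ y, gradient (fun θ' => f (T θ' y)) θ ∂β)) := by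
  refine ⟨fun β _ => ?_, fun {Ω'} _ _ _ _ β _ p T hT => ?_⟩
  · obtain ⟨f, hf⟩ := exists_isKRPotential hh α β
    refine ⟨⟨?_, fun b hb => ?_⟩, f, hf⟩
    · rintro _ ⟨g, hg, rfl⟩
      exact krFunctional_le_boundedDistanceW1 hh α β hg
    · rw [← hf.krFunctional_eq hh]
      exact hb (mem_image_of_mem _ hf.1)
  · have hlip := locallyLipschitz_boundedDistanceW1_map hh α β hT
    refine ⟨hlip, hlip.continuous, hlip.ae_differentiableAt volume, fun θ f hf hL hd => ?_⟩
    obtain ⟨hint, heq⟩ :=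
      integrable_gradient_and_integral_eq (hasFDerivAt_integral_comp hT β hf.1.1 hd).1
    refine ⟨hint, ?_⟩
    rw [heq, gradient, fderiv_boundedDistanceW1_map hh hT hf hL hd, map_neg]
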